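/- Let $A\in\mathbb{C}^{N\times N}$. For delays $m=(m_1,\dots,m_N)$ with integers $m_i\ge 1$ put $p_{A,m}(z)=\det\left(\operatorname{diag}(z^{m_1},\dots,z^{m_N})-A\right)$. Call $A$ unilossless if, for every choice of $m$, all complex roots of $p_{A,m}$ have modulus $1$. Call $A$ reducible if there is a permutation matrix $P$ with $P^{-1}AP=\begin{bmatrix}E&G\\0&F\end{bmatrix}$, where $E$ and $F$ are square of positive size, and irreducible otherwise. The irreducible components of $A$ are the diagonal blocks of a block upper triangular form of $A$, obtained by a simultaneous permutation of rows and columns, all of whose diagonal blocks are irreducible. Then $A$ is unilossless if and only if at least one of the following holds: 1. $A$ is reducible and all its irreducible components are unilossless; 2. there is a diagonal matrix $E$ with positive diagonal entries such that $A E A^{\mathsf H}=E$. Moreover, condition 2 holds if and only if $A$ is diagonally similar to a unitary matrix, that is, there is a nonsingular diagonal matrix $F$ such that $F^{-1}AF$ is unitary. -/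

import Mathlib

namespace FDN

open Polynomial

/-- The generalized characteristic polynomial `det (diag (z ^ m i) - A)` of a feedback matrix `A`
with delays `m`. -/
noncomputable def genCharpoly {ι : Type*} [Fintype ι] [DecidableEq ι]
    (A : Matrix ι ι ℂ) (m : ι → ℕ) : ℂ[X] :=
  (Matrix.diagonal (fun i => (X : ℂ[X]) ^ m i) - A.map C).det

/-- A polynomial is lossless if all its complex roots are unimodular. -/
def IsLossless (p : ℂ[X]) : Prop :=
  ∀ z : ℂ, p.IsRoot z → ‖z‖ = 1

/-- `A` is unilossless if its generalized characteristic polynomial is lossless for every choice of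
positive integer delays. -/
def IsUnilossless {ι : Type*} [Fintype ι] [DecidableEq ι] (A : Matrix ι ι ℂ) : Prop :=
  ∀ m : ι → ℕ, (∀ i, 1 ≤ m i) → IsLossless (genCharpoly A m)

/-- `A` is reducible if some simultaneous permutation of its rows and columns brings it to the form
`[E G; 0 F]` with `E` and `F` square and of positive size. -/
def IsReducible {ι : Type*} (A : Matrix ι ι ℂ) : Prop :=
  ∃ (p q : ℕ) (σ : Fin p ⊕ Fin q ≃ ι) (E : Matrix (Fin p) (Fin p) ℂ)
    (G : Matrix (Fin p) (Fin q) ℂ) (F : Matrix (Fin q) (Fin q) ℂ),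
    0 < p ∧ 0 < q ∧ A.submatrix σ σ = Matrix.fromBlocks E G 0 F

/-- `b` sorts the indices into `k` nonempty blocks (listed in order) for which `A` becomes block
upper triangular with irreducible diagonal blocks. -/
structure IsIrreducibleBlockForm {ι : Type*} (A : Matrix ι ι ℂ) {k : ℕ} (b : ι → Fin k) :
    Prop where
  surjective : Function.Surjective b
  blockTriangular : A.BlockTriangular b
  irreducible : ∀ c : Fin k, ¬ IsReducible (A.toSquareBlock b c)

/-- All irreducible components of `A`, that is, all diagonal blocks of its block triangular forms
with irreducible diagonal blocks, are unilossless. -/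
def AllComponentsUnilossless {ι : Type*} [Fintype ι] [DecidableEq ι] (A : Matrix ι ι ℂ) : Prop :=
  ∀ (k : ℕ) (b : ι → Fin k), IsIrreducibleBlockForm A b →
    ∀ c : Fin k, IsUnilossless (A.toSquareBlock b c)

/-- There is a diagonal matrix `E` with positive diagonal entries such that `A E Aᴴ = E`. -/
def HasPositiveDiagonalInvariant {ι : Type*} [Fintype ι] [DecidableEq ι]
    (A : Matrix ι ι ℂ) : Prop :=
  ∃ e : ι → ℝ, (∀ i, 0 < e i) ∧
    A * Matrix.diagonal (fun i => (e i : ℂ)) * A.conjTranspose =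
      Matrix.diagonal (fun i => (e i : ℂ))

/-- `A` is similar to a unitary matrix through a nonsingular complex diagonal matrix. -/
def IsDiagonallySimilarToUnitary {ι : Type*} [Fintype ι] [DecidableEq ι]
    (A : Matrix ι ι ℂ) : Prop :=
  ∃ f : ι → ℂ, (∀ i, f i ≠ 0) ∧
    (Matrix.diagonal f)⁻¹ * A * Matrix.diagonal f ∈ Matrix.unitaryGroup ι ℂ

end FDN

namespace FDN

open Polynomial Matrix Filter Topology
open scoped ComplexOrder

variable {ι : Type*} [Fintype ι] [DecidableEq ι]

/-! The hard direction is that an irreducible unilossless `A` has an invariant `E`. Varying the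
delays turns a family of one-variable statements into statements about `D(w) = det (diag w - A)` on
the torus `|w k| = 1`. Every tuple of roots of unity consists of positive powers of a single one,
and such tuples are dense. Thus `D` inherits two properties of monic lossless polynomials:
self-inversiveness, and a lower bound on growth when two coordinates are scaled up.

These are read off entrywise from `T = W (W - A)⁻¹`, where `W = diag w` and `D(w) ≠ 0`.
Self-inversiveness gives `Re (T i i) = 1/2`. Growth in two coordinates gives `T i j * T j i ≤ 0` for
`i ≠ j`. Rotating a third coordinate `w k` keeps this sign, so a real quadratic in the rotation
parameter is nonnegative; this forces `T i k * T k j * T j i = -conj (T i j * T j k * T k i)`. By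
irreducibility all off-diagonal entries of `T` are nonzero for some `w`. The sign and cycle
relations then produce a positive diagonal `G` with `Tᴴ G + G T = G`, which unwinds to `Aᴴ G A = G`,
and `E = G⁻¹`.

The rest is softer. The determinant factors over the blocks of a block triangular form, which
settles the reducible case. An invariant `E` is a norm preserved by `A`, which puts all roots on the
unit circle. Writing `E = F Fᴴ` gives the similarity to a unitary matrix. -/

/-! ### Degree and leading term of the generalized characteristic polynomial -/

theorem eval_genCharpoly (A : Matrix ι ι ℂ) (m : ι → ℕ) (z : ℂ) :
    (genCharpoly A m).eval z = (diagonal (fun i => z ^ m i) - A).det := by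
  rw [genCharpoly, ← coe_evalRingHom, RingHom.map_det]
  congr 1
  ext i j
  by_cases h : i = j <;> simp [h, diagonal]

/-- In the Leibniz expansion, a permutation that moves `k` loses the factor of degree `m k ≥ 1`. -/
theorem genCharpoly_sub_prod_degree_lt (A : Matrix ι ι ℂ) {m : ι → ℕ} (hm : ∀ i, 1 ≤ m i) :
    (genCharpoly A m - ∏ i, ((X : ℂ[X]) ^ m i - C (A i i))).degree < (∑ i, m i : ℕ) := by
  rw [genCharpoly, det_apply, ← Finset.add_sum_erase _ _ (Finset.mem_univ (1 : Equiv.Perm ι))]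
  simp only [Equiv.Perm.sign_one, one_smul, Equiv.Perm.one_apply, Matrix.sub_apply, diagonal_apply_eq,
    map_apply, add_sub_cancel_left]
  refine (degree_sum_le _ _).trans_lt ?_
  rw [Finset.sup_lt_iff (WithBot.bot_lt_coe _)]
  intro σ hσ
  have hσ1 : σ ≠ 1 := (Finset.mem_erase.mp hσ).1
  obtain ⟨k, hk⟩ : ∃ k, σ k ≠ k := by
    by_contra! h
    exact hσ1 (Equiv.ext h)
  have hdeg : ∀ i, (((diagonal (fun i => (X : ℂ[X]) ^ m i)) (σ i) i - C (A (σ i) i)) :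
      ℂ[X]).natDegree ≤ if σ i = i then m i else 0 := by
    intro i
    split_ifs with h
    · rw [h, diagonal_apply_eq]
      exact (natDegree_sub_C).le.trans (natDegree_X_pow_le _)
    · rw [diagonal_apply_ne _ h]
      simp
  have hsmul : ∀ q : ℂ[X], (Equiv.Perm.sign σ • q).degree = q.degree := by
    intro q
    rcases Int.units_eq_one_or (Equiv.Perm.sign σ) with h | h <;> simp [h, Units.smul_def]
  rw [hsmul]
  refine degree_le_natDegree.trans_lt ?_
  rw [Nat.cast_lt]
  refine (natDegree_prod_le _ _).trans_lt ((Finset.sum_le_sum fun i _ => hdeg i).trans_lt ?_)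
  refine Finset.sum_lt_sum (fun i _ => ?_) ⟨k, Finset.mem_univ _, ?_⟩
  · split_ifs <;> simp
  · rw [if_neg hk]
    exact hm k

theorem genCharpoly_monic (A : Matrix ι ι ℂ) {m : ι → ℕ} (hm : ∀ i, 1 ≤ m i) :
    (genCharpoly A m).Monic ∧ (genCharpoly A m).natDegree = ∑ i, m i := by
  have hmon : (∏ i, ((X : ℂ[X]) ^ m i - C (A i i))).Monic :=
    monic_prod_of_monic _ _ fun i _ => monic_X_pow_sub_C _ (by have := hm i; omega)
  have hdeg : (∏ i, ((X : ℂ[X]) ^ m i - C (A i i))).natDegree = ∑ i, m i := by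
    rw [natDegree_prod_of_monic _ _ fun i _ => monic_X_pow_sub_C _ (by have := hm i; omega)]
    simp
  have hlt := genCharpoly_sub_prod_degree_lt A hm
  rw [← hdeg, ← degree_eq_natDegree hmon.ne_zero] at hlt
  rw [← add_sub_cancel (∏ i, ((X : ℂ[X]) ^ m i - C (A i i))) (genCharpoly A m)]
  exact ⟨hmon.add_of_left hlt, (natDegree_add_eq_left_of_degree_lt hlt).trans hdeg⟩

/-! ### Self-inversiveness and radial growth of lossless polynomials -/

/-- Each factor satisfies `z - a = (-a) * z * conj (z - a)` when `z` and `a` are unimodular. -/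
theorem multiset_prod_sub_eq_conj (s : Multiset ℂ) (hs : ∀ a ∈ s, ‖a‖ = 1) {z : ℂ}
    (hz : ‖z‖ = 1) :
    (s.map fun a => z - a).prod = (s.map fun a => 0 - a).prod * z ^ s.card *
      (starRingEnd ℂ) (s.map fun a => z - a).prod := by
  induction s using Multiset.induction_on with
  | empty => simp
  | cons a s ih =>
    have ha := hs a (Multiset.mem_cons_self a s)
    have hs' := ih fun b hb => hs b (Multiset.mem_cons_of_mem hb)
    simp only [Multiset.map_cons, Multiset.prod_cons, Multiset.card_cons, map_mul]
    have h1 : z * (starRingEnd ℂ) z = 1 := by rw [Complex.mul_conj']; simp [hz]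
    have h2 : a * (starRingEnd ℂ) a = 1 := by rw [Complex.mul_conj']; simp [ha]
    have h3 : z - a = (0 - a) * z * (starRingEnd ℂ) (z - a) := by
      rw [map_sub]
      linear_combination a * h1 - z * h2
    rw [pow_succ]
    linear_combination (Multiset.map (fun a => z - a) s).prod * h3 +
      (0 - a) * z * (starRingEnd ℂ) (z - a) * hs'

/-- The difference of the two sides is exactly `(r - 1) ^ 2`. -/
theorem norm_mul_sub_sq_ge {z a : ℂ} (hz : ‖z‖ = 1) (ha : ‖a‖ = 1) {r : ℝ} (hr : 0 ≤ r) :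
    r * ‖z - a‖ ^ 2 ≤ ‖(r : ℂ) * z - a‖ ^ 2 := by
  have h1 : ‖z‖ ^ 2 = 1 := by rw [hz]; norm_num
  have h2 : ‖a‖ ^ 2 = 1 := by rw [ha]; norm_num
  simp only [← Complex.normSq_eq_norm_sq, Complex.normSq_apply] at *
  simp only [Complex.sub_re, Complex.sub_im, Complex.mul_re, Complex.mul_im, Complex.ofReal_re,
    Complex.ofReal_im, zero_mul, sub_zero, add_zero]
  nlinarith [sq_nonneg (r - 1)]

theorem multiset_norm_prod_sub_sq_ge (s : Multiset ℂ) (hs : ∀ a ∈ s, ‖a‖ = 1) {z : ℂ}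
    (hz : ‖z‖ = 1) {r : ℝ} (hr : 0 ≤ r) :
    r ^ s.card * ‖(s.map fun a => z - a).prod‖ ^ 2 ≤
      ‖(s.map fun a => (r : ℂ) * z - a).prod‖ ^ 2 := by
  induction s using Multiset.induction_on with
  | empty => simp
  | cons a s ih =>
    have ha := hs a (Multiset.mem_cons_self a s)
    have hs' := ih fun b hb => hs b (Multiset.mem_cons_of_mem hb)
    simp only [Multiset.map_cons, Multiset.prod_cons, Multiset.card_cons, norm_mul, mul_pow]
    calc _ = (r * ‖z - a‖ ^ 2) * (r ^ s.card * ‖(s.map fun a => z - a).prod‖ ^ 2) := by ring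
      _ ≤ _ := mul_le_mul (norm_mul_sub_sq_ge hz ha hr) hs' (by positivity) (by positivity)

theorem eval_eq_prod_roots {p : ℂ[X]} (hp : p.Monic) (z : ℂ) :
    p.eval z = (p.roots.map fun a => z - a).prod := by
  conv_lhs => rw [(IsAlgClosed.splits p).eq_prod_roots_of_monic hp]
  rw [eval_multiset_prod, Multiset.map_map]
  simp

theorem IsLossless.eval_eq_conj {p : ℂ[X]} (h : IsLossless p) (hp : p.Monic) {z : ℂ}
    (hz : ‖z‖ = 1) :
    p.eval z = p.eval 0 * z ^ p.natDegree * (starRingEnd ℂ) (p.eval z) := by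
  rw [eval_eq_prod_roots hp, eval_eq_prod_roots hp,
    (IsAlgClosed.splits p).natDegree_eq_card_roots]
  exact multiset_prod_sub_eq_conj _ (fun a ha => h a (isRoot_of_mem_roots ha)) hz

theorem IsLossless.norm_eval_sq_ge {p : ℂ[X]} (h : IsLossless p) (hp : p.Monic) {z : ℂ}
    (hz : ‖z‖ = 1) {r : ℝ} (hr : 0 ≤ r) :
    r ^ p.natDegree * ‖p.eval z‖ ^ 2 ≤ ‖p.eval ((r : ℂ) * z)‖ ^ 2 := by
  rw [eval_eq_prod_roots hp, eval_eq_prod_roots hp,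
    (IsAlgClosed.splits p).natDegree_eq_card_roots]
  exact multiset_norm_prod_sub_sq_ge _ (fun a ha => h a (isRoot_of_mem_roots ha)) hz hr

/-! ### Density on the torus -/

theorem mem_closure_roots_of_unity {u : ℂ} (hu : ‖u‖ = 1) :
    u ∈ closure {v : ℂ | ∃ L : ℕ, 0 < L ∧ v ^ L = 1} := by
  have hcont : Continuous fun x : ℝ => Complex.exp (2 * Real.pi * Complex.I * x) := by fun_prop
  have hx : u = (fun x : ℝ => Complex.exp (2 * Real.pi * Complex.I * x))
      (u.arg / (2 * Real.pi)) := by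
    have hpi : (Real.pi : ℂ) ≠ 0 := by exact_mod_cast Real.pi_ne_zero
    conv_lhs => rw [← Complex.norm_mul_exp_arg_mul_I u, hu]
    simp only [Complex.ofReal_one, one_mul, Complex.ofReal_div, Complex.ofReal_mul,
      Complex.ofReal_ofNat]
    congr 1
    field_simp
  rw [hx]
  refine map_mem_closure (f := fun x : ℝ => Complex.exp (2 * Real.pi * Complex.I * x)) hcont (Rat.denseRange_cast (𝕜 := ℝ) _) ?_
  rintro _ ⟨q, rfl⟩
  refine ⟨q.den, q.pos, ?_⟩
  rw [← Complex.exp_nat_mul, Complex.exp_eq_one_iff]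
  refine ⟨q.num, ?_⟩
  have h : (q.den : ℂ) * q = q.num := by exact_mod_cast Rat.den_mul_eq_num q
  push_cast
  linear_combination 2 * Real.pi * Complex.I * h

/-- A closed condition that holds at vectors of roots of unity holds on the whole torus. -/
theorem torus_subset_of_roots_of_unity {S : Set (ι → ℂ)} (hS : IsClosed S)
    (h : ∀ (w : ι → ℂ) (L : ℕ), 0 < L → (∀ k, w k ^ L = 1) → w ∈ S) {w : ι → ℂ}
    (hw : ∀ k, ‖w k‖ = 1) : w ∈ S := by
  have hmem : w ∈ closure (Set.pi Set.univ fun _ : ι => {v : ℂ | ∃ L : ℕ, 0 < L ∧ v ^ L = 1}) := by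
    rw [closure_pi_set]
    exact fun k _ => mem_closure_roots_of_unity (hw k)
  refine closure_minimal ?_ hS hmem
  intro v hv
  choose L hL hvL using fun k => hv k (Set.mem_univ k)
  refine h v (∏ k, L k) (Finset.prod_pos fun k _ => hL k) fun k => ?_
  rw [← Finset.mul_prod_erase _ _ (Finset.mem_univ k), pow_mul, hvL, one_pow]

theorem infinite_circle_inter_nhds {u : ℂ} (hu : ‖u‖ = 1) {V : Set ℂ} (hV : V ∈ 𝓝 u) :
    {v : ℂ | ‖v‖ = 1 ∧ v ∈ V}.Infinite := by
  have hcont : Continuous fun x : ℝ => u * Complex.exp (x * Complex.I) := by fun_prop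
  have hnhds : (fun x : ℝ => u * Complex.exp (x * Complex.I)) ⁻¹' V ∩ Set.Ioo (-Real.pi) Real.pi
      ∈ 𝓝 (0 : ℝ) := by
    refine inter_mem (hcont.continuousAt.preimage_mem_nhds (by simpa using hV)) ?_
    exact Ioo_mem_nhds (by linarith [Real.pi_pos]) Real.pi_pos
  refine ((infinite_of_mem_nhds _ hnhds).image (f := fun x : ℝ => u * Complex.exp (x * Complex.I))
    ?_).mono ?_
  · intro x hx y hy hxy
    have hu0 : u ≠ 0 := by
      rintro rfl
      simp at hu
    have he := mul_left_cancel₀ hu0 hxy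
    have h1 := Complex.arg_exp_mul_I x
    rw [he, Complex.arg_exp_mul_I] at h1
    rw [(toIocMod_eq_self _).2, (toIocMod_eq_self _).2] at h1
    · exact h1.symm
    · exact ⟨hx.2.1, by linarith [hx.2.2]⟩
    · exact ⟨hy.2.1, by linarith [hy.2.2]⟩
  · rintro _ ⟨x, hx, rfl⟩
    exact ⟨by simp [hu, Complex.norm_exp_ofReal_mul_I], hx.1⟩

/-- A nonzero polynomial is nonzero on a dense subset of the torus. -/
theorem mem_closure_torus_eval_ne_zero {κ : Type*} {q : MvPolynomial κ ℂ} (hq : q ≠ 0) {w : κ → ℂ}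
    (hw : ∀ k, ‖w k‖ = 1) :
    w ∈ closure {v : κ → ℂ | (∀ k, ‖v k‖ = 1) ∧ MvPolynomial.eval v q ≠ 0} := by
  rw [mem_closure_iff_nhds]
  intro V hV
  rw [nhds_pi, Filter.mem_pi'] at hV
  obtain ⟨I, t, ht, hsub⟩ := hV
  by_contra hemp
  refine hq ?_
  have hinf : ∀ k, {v : ℂ | ‖v‖ = 1 ∧ v ∈ t k}.Infinite := fun k =>
    infinite_circle_inter_nhds (hw k) (ht k)
  refine MvPolynomial.funext_set (fun k => {v : ℂ | ‖v‖ = 1 ∧ v ∈ t k}) (fun k => hinf k) ?_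
  intro v hv
  by_contra hne
  refine hemp ⟨v, hsub fun k _ => (hv k (Set.mem_univ k)).2, fun k => (hv k (Set.mem_univ k)).1, ?_⟩
  simpa using hne

/-! ### From delays to a multivariate determinant -/

theorem continuous_det_diagonal_sub (A : Matrix ι ι ℂ) :
    Continuous fun w : ι → ℂ => (diagonal w - A).det := by fun_prop

theorem exists_delays_of_pow_eq_one {κ : Type*} {w : κ → ℂ} {L : ℕ} (hL : 0 < L) (hw : ∀ k, w k ^ L = 1) :
    ∃ (z : ℂ) (r : κ → ℕ), ‖z‖ = 1 ∧ z ^ L = 1 ∧ (∀ k, 1 ≤ r k) ∧ ∀ k, z ^ r k = w k := by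
  have : NeZero L := ⟨hL.ne'⟩
  have hz := Complex.isPrimitiveRoot_exp L hL.ne'
  choose i hi hiw using fun k => hz.eq_pow_of_pow_eq_one (hw k)
  -- Adding `L` makes the exponent positive without changing the power.
  refine ⟨_, fun k => i k + L, hz.norm'_eq_one hL.ne', hz.pow_eq_one, fun k => Nat.le_add_left_of_le hL,
    fun k => ?_⟩
  rw [pow_add, hz.pow_eq_one, mul_one, hiw]

theorem IsUnilossless.det_eq_conj {A : Matrix ι ι ℂ} (hA : IsUnilossless A) {w : ι → ℂ}
    (hw : ∀ k, ‖w k‖ = 1) :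
    (diagonal w - A).det = (-A).det * (∏ k, w k) * (starRingEnd ℂ) (diagonal w - A).det := by
  refine torus_subset_of_roots_of_unity (S := {w : ι → ℂ | (diagonal w - A).det =
    (-A).det * (∏ k, w k) * (starRingEnd ℂ) (diagonal w - A).det}) ?_ ?_ hw
  · have := continuous_det_diagonal_sub A
    exact isClosed_eq this ((continuous_const.mul (by fun_prop)).mul
      (Complex.continuous_conj.comp this))
  · intro w L hL hwL
    obtain ⟨z, r, hz, -, hr, hzr⟩ := exists_delays_of_pow_eq_one hL hwL
    obtain ⟨hmon, hdeg⟩ := genCharpoly_monic A hr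
    have h := (hA r hr).eval_eq_conj hmon hz
    have h0 : (fun i => (0 : ℂ) ^ r i) = 0 := by
      ext i
      exact zero_pow (by have := hr i; omega)
    simp only [eval_genCharpoly, hdeg, hzr, h0, ← Finset.prod_pow_eq_pow_sum] at h
    simpa using h

theorem tendsto_rpow_inv_nat_mul {x : ℝ} (hx : 1 ≤ x) {L : ℕ} (hL : 0 < L) :
    Tendsto (fun n : ℕ => x ^ (((n + 1) * L : ℕ) : ℝ)⁻¹) atTop (𝓝 1) := by
  have h : Tendsto (fun n : ℕ => (((n + 1) * L : ℕ) : ℝ)⁻¹) atTop (𝓝 0) := by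
    refine tendsto_inv_atTop_zero.comp (tendsto_natCast_atTop_atTop.comp ?_)
    exact tendsto_atTop_mono (fun n => by simp only [id]; nlinarith) tendsto_id
  simpa using (tendsto_const_nhds (x := x)).rpow h (Or.inl (by linarith))

/-- Scaling two coordinates of a torus point by `x ≥ 1` scales the determinant by at least `x`. -/
theorem IsUnilossless.norm_det_ge {A : Matrix ι ι ℂ} (hA : IsUnilossless A) {i j : ι}
    (hij : i ≠ j) {x : ℝ} (hx : 1 ≤ x) {w : ι → ℂ} (hw : ∀ k, ‖w k‖ = 1) :
    x ^ 2 * ‖(diagonal w - A).det‖ ^ 2 ≤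
      ‖(diagonal (fun k => ((if k = i ∨ k = j then x else 1 : ℝ) : ℂ) * w k) - A).det‖ ^ 2 := by
  refine torus_subset_of_roots_of_unity (S := {w : ι → ℂ | x ^ 2 * ‖(diagonal w - A).det‖ ^ 2 ≤
      ‖(diagonal (fun k => ((if k = i ∨ k = j then x else 1 : ℝ) : ℂ) * w k) - A).det‖ ^ 2})
      ?_ ?_ hw
  · exact isClosed_le (by fun_prop) (by fun_prop)
  · intro w L hL hwL
    obtain ⟨z, r, hz, hzL, hr, hzr⟩ := exists_delays_of_pow_eq_one hL hwL
    have hx0 : 0 ≤ x := by linarith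
    set ρ : ℕ → ℝ := fun n => x ^ (((n + 1) * L : ℕ) : ℝ)⁻¹ with hρ
    have hρ0 : ∀ n, 0 ≤ ρ n := fun n => Real.rpow_nonneg hx0 _
    have hρlim : Tendsto ρ atTop (𝓝 1) := tendsto_rpow_inv_nat_mul hx hL
    have hρpow : ∀ n, ρ n ^ ((n + 1) * L) = x := fun n =>
      Real.rpow_inv_natCast_pow hx0 (by positivity)
    -- Evaluation is at `ρ n * z`. The extra delay `(n + 1) * L` leaves the phase unchanged because
    -- `z ^ L = 1`, and contributes the modulus `x` at `i` and `j`. As `ρ n → 1`, the moduli coming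
    -- from `r` disappear in the limit.
    let m : ℕ → ι → ℕ := fun n k => r k + if k = i ∨ k = j then (n + 1) * L else 0
    have hρm : ∀ n k, ρ n ^ m n k = ρ n ^ r k * if k = i ∨ k = j then x else 1 := by
      intro n k
      simp only [m, pow_add]
      split_ifs <;> simp [hρpow]
    have hzm : ∀ n k, z ^ m n k = w k := by
      intro n k
      simp only [m, pow_add, hzr]
      split_ifs <;> simp [pow_mul', hzL]
    have hprod : ∏ k, (if k = i ∨ k = j then x else 1) = x ^ 2 := by
      rw [Finset.prod_ite]
      simp only [Finset.prod_const, one_pow, mul_one]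
      congr 1
      have : (Finset.univ.filter fun k => k = i ∨ k = j) = {i, j} := by ext; simp
      rw [this, Finset.card_pair hij]
    have key : ∀ n, (∏ k, ρ n ^ r k) * x ^ 2 * ‖(diagonal w - A).det‖ ^ 2 ≤
        ‖(diagonal (fun k => ((ρ n ^ r k : ℝ) : ℂ) *
          (((if k = i ∨ k = j then x else 1 : ℝ) : ℂ) * w k)) - A).det‖ ^ 2 := by
      intro n
      have hm : ∀ k, 1 ≤ m n k := fun k => (hr k).trans (Nat.le_add_right _ _)
      obtain ⟨hmon, hdeg⟩ := genCharpoly_monic A hm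
      have h := (hA _ hm).norm_eval_sq_ge hmon hz (hρ0 n)
      simp only [eval_genCharpoly, hdeg, ← Finset.prod_pow_eq_pow_sum, mul_pow, hzm, hρm,
        Finset.prod_mul_distrib, hprod, ← Complex.ofReal_pow] at h
      simpa only [Complex.ofReal_mul, mul_assoc] using h
    have hlim1 : Tendsto (fun n => (∏ k, ρ n ^ r k) * x ^ 2 * ‖(diagonal w - A).det‖ ^ 2) atTop
        (𝓝 ((∏ k : ι, (1 : ℝ) ^ r k) * x ^ 2 * ‖(diagonal w - A).det‖ ^ 2)) :=
      ((by fun_prop : Continuous fun ρ : ℝ =>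
        (∏ k, ρ ^ r k) * x ^ 2 * ‖(diagonal w - A).det‖ ^ 2).tendsto 1).comp hρlim
    have hlim2 := ((by fun_prop : Continuous fun ρ : ℝ =>
        ‖(diagonal (fun k => ((ρ ^ r k : ℝ) : ℂ) *
          (((if k = i ∨ k = j then x else 1 : ℝ) : ℂ) * w k)) - A).det‖ ^ 2).tendsto 1).comp hρlim
    have := le_of_tendsto_of_tendsto' hlim1 hlim2 key
    simpa using this

/-! ### The scaled resolvent and the real parts of its diagonal -/

/-- The resolvent `diag(w) (diag(w) - A)⁻¹ = (1 - A diag(w)⁻¹)⁻¹`. -/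
noncomputable def scaledResolvent (A : Matrix ι ι ℂ) (w : ι → ℂ) : Matrix ι ι ℂ :=
  diagonal w * (diagonal w - A)⁻¹

theorem scaledResolvent_apply (A : Matrix ι ι ℂ) (w : ι → ℂ) (i j : ι) :
    scaledResolvent A w i j = w i * (diagonal w - A)⁻¹ i j := by
  rw [scaledResolvent, diagonal_mul]

theorem scaledResolvent_apply_eq_div (A : Matrix ι ι ℂ) (w : ι → ℂ) (i j : ι) :
    scaledResolvent A w i j =
      w i * (diagonal w - A).adjugate i j / (diagonal w - A).det := by
  rw [scaledResolvent_apply, Matrix.inv_def, Ring.inverse_eq_inv', Matrix.smul_apply, smul_eq_mul]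
  ring

/-- A rank-one perturbation, handled by the matrix determinant lemma. -/
theorem det_update_one {A : Matrix ι ι ℂ} {w : ι → ℂ} (hdet : (diagonal w - A).det ≠ 0)
    (i : ι) (u : ℂ) :
    (diagonal (Function.update w i (u * w i)) - A).det =
      (diagonal w - A).det * (1 + (u - 1) * scaledResolvent A w i i) := by
  have hsum : diagonal (Function.update w i (u * w i)) - A = (diagonal w - A) +
      (Matrix.of fun (k : ι) (_ : Unit) => if k = i then (u - 1) * w i else 0) *
        (Matrix.of fun (_ : Unit) (l : ι) => if l = i then (1 : ℂ) else 0) := by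
    ext k l
    simp only [Matrix.sub_apply, Matrix.add_apply, Matrix.mul_apply, diagonal_apply,
      Function.update_apply, of_apply, Finset.univ_unique, Finset.sum_singleton]
    split_ifs <;> simp_all
    ring
  rw [hsum, det_add_mul _ _ (isUnit_iff_ne_zero.mpr hdet)]
  congr 1
  simp [Matrix.mul_apply, scaledResolvent_apply]
  ring

theorem det_update_two {A : Matrix ι ι ℂ} {w : ι → ℂ} (hdet : (diagonal w - A).det ≠ 0)
    {i j : ι} (hij : i ≠ j) (u v : ℂ) :
    (diagonal (Function.update (Function.update w i (u * w i)) j (v * w j)) - A).det =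
      (diagonal w - A).det * ((1 + (u - 1) * scaledResolvent A w i i) *
        (1 + (v - 1) * scaledResolvent A w j j) -
          (u - 1) * (v - 1) * (scaledResolvent A w i j * scaledResolvent A w j i)) := by
  have hsum : diagonal (Function.update (Function.update w i (u * w i)) j (v * w j)) - A =
      (diagonal w - A) +
      (Matrix.of fun (k : ι) (a : Fin 2) =>
        if a = 0 then (if k = i then (u - 1) * w i else 0) else if k = j then (v - 1) * w j else 0) *
        (Matrix.of fun (a : Fin 2) (l : ι) =>
          if a = 0 then (if l = i then (1 : ℂ) else 0) else if l = j then 1 else 0) := by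
    ext k l
    simp only [Matrix.sub_apply, Matrix.add_apply, Matrix.mul_apply, diagonal_apply,
      Function.update_apply, of_apply, Fin.sum_univ_two, if_true, one_ne_zero, if_false]
    split_ifs <;> simp_all <;> grind
  rw [hsum, det_add_mul _ _ (isUnit_iff_ne_zero.mpr hdet)]
  congr 1
  simp [Matrix.mul_apply, scaledResolvent_apply, det_fin_two]
  ring

theorem norm_update_mul {κ : Type*} [DecidableEq κ] {w : κ → ℂ} (hw : ∀ k, ‖w k‖ = 1) (i : κ)
    {u : ℂ} (hu : ‖u‖ = 1) (k : κ) :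
    ‖Function.update w i (u * w i) k‖ = 1 := by
  rw [Function.update_apply]
  split_ifs <;> simp [hu, hw]

theorem IsUnilossless.scaledResolvent_diag {A : Matrix ι ι ℂ} (hA : IsUnilossless A)
    {w : ι → ℂ} (hw : ∀ k, ‖w k‖ = 1) (hdet : (diagonal w - A).det ≠ 0) (i : ι) :
    scaledResolvent A w i i + (starRingEnd ℂ) (scaledResolvent A w i i) = 1 := by
  have h1 := hA.det_eq_conj hw
  -- Flipping the sign of `w i` multiplies the determinant by `1 - 2 * T i i` and the product of the
  -- coordinates by `-1`, so `1 - 2 * T i i` is purely imaginary.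
  have h2 := hA.det_eq_conj (norm_update_mul hw i (u := -1) (by simp))
  rw [det_update_one hdet, Finset.prod_update_of_mem (Finset.mem_univ i),
    ← Finset.erase_eq, mul_assoc (-1 : ℂ), Finset.mul_prod_erase _ _ (Finset.mem_univ i)] at h2
  have h3 : (diagonal w - A).det * (2 * (1 - (scaledResolvent A w i i +
      (starRingEnd ℂ) (scaledResolvent A w i i)))) = 0 := by
    simp only [map_mul, map_add, map_sub, map_one, map_neg] at h2
    linear_combination h2 + (1 - 2 * (starRingEnd ℂ) (scaledResolvent A w i i)) * h1
  have h4 := (mul_eq_zero.mp h3).resolve_left hdet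
  linear_combination -h4 / 2

/-! ### Sign of products of opposite off-diagonal entries -/

/-- A bi-affine polynomial that is self-inversive on the torus and grows when both variables are
scaled up is dominated by its leading coefficient. -/
theorem norm_le_of_biaffine_growth {a b c d : ℂ}
    (hself : ∀ u v : ℂ, ‖u‖ = 1 → ‖v‖ = 1 → a * u * v + b * u + c * v + d =
      u * v * (starRingEnd ℂ) (a * u * v + b * u + c * v + d))
    (hgrow : ∀ u v : ℂ, ‖u‖ = 1 → ‖v‖ = 1 → ∀ x : ℝ, 1 ≤ x →
      x ^ 2 * ‖a * u * v + b * u + c * v + d‖ ^ 2 ≤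
        ‖a * (x * u) * (x * v) + b * (x * u) + c * (x * v) + d‖ ^ 2)
    (ha : a ≠ 0) :
    d = (starRingEnd ℂ) a ∧ c = (starRingEnd ℂ) b ∧ ‖b‖ ≤ ‖a‖ := by
  have h1 := hself 1 1 (by simp) (by simp)
  have h2 := hself 1 (-1) (by simp) (by simp)
  have h3 := hself (-1) 1 (by simp) (by simp)
  have h4 := hself (-1) (-1) (by simp) (by simp)
  simp only [map_add, map_mul, map_neg, map_one] at h1 h2 h3 h4
  have hd : d = (starRingEnd ℂ) a := by linear_combination (h1 + h2 + h3 + h4) / 4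
  have hc : c = (starRingEnd ℂ) b := by linear_combination (h1 - h2 + h3 - h4) / 4
  refine ⟨hd, hc, ?_⟩
  by_contra! hlt
  have ha0 : 0 < ‖a‖ := norm_pos_iff.mpr ha
  have hb0 : 0 < ‖b‖ := ha0.trans hlt
  have hb : b ≠ 0 := norm_pos_iff.mp hb0
  have ha0' : (‖a‖ : ℂ) ≠ 0 := by exact_mod_cast ha0.ne'
  have hb0' : (‖b‖ : ℂ) ≠ 0 := by exact_mod_cast hb0.ne'
  have hbc : (starRingEnd ℂ) b ≠ 0 := by simpa using hb
  have haa : a * (starRingEnd ℂ) a = (‖a‖ : ℂ) ^ 2 := Complex.mul_conj' a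
  have hbb : b * (starRingEnd ℂ) b = (‖b‖ : ℂ) ^ 2 := Complex.mul_conj' b
  set η : ℂ := (starRingEnd ℂ) a / ‖a‖ with hη
  have hη1 : ‖η‖ = 1 := by simp [hη, ha0.ne']
  have haη : a * η = ‖a‖ := by
    rw [hη]; field_simp; exact haa
  have hdη : d = ‖a‖ * η := by
    rw [hη, hd]; field_simp
  -- The phases are chosen so that along the ray `(x * u, x * v)` the polynomial becomes `η * (‖a‖
  -- x² - 2 ‖b‖ x + ‖a‖)`, a real quadratic up to phase.
  set u : ℂ := -(‖b‖ * η / b) with hu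
  set v : ℂ := -(‖b‖ * η / (starRingEnd ℂ) b) with hv
  have hu1 : ‖u‖ = 1 := by simp [hu, hη1, hb0.ne']
  have hv1 : ‖v‖ = 1 := by simp [hv, hη1, hb0.ne']
  have hbu : b * u = -(‖b‖ * η) := by rw [hu]; field_simp
  have hcv : c * v = -(‖b‖ * η) := by rw [hv, hc]; field_simp
  have huv : u * v = η ^ 2 := by
    rw [hu, hv]
    field_simp
    rw [← hbb]
    field_simp
  have hval : ∀ x : ℝ, a * (x * u) * (x * v) + b * (x * u) + c * (x * v) + d =
      η * ((‖a‖ * x ^ 2 - 2 * ‖b‖ * x + ‖a‖ : ℝ) : ℂ) := by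
    intro x
    push_cast
    linear_combination a * x ^ 2 * huv + x * hbu + x * hcv + hdη + x ^ 2 * η * haη
  have hsq : 0 ≤ ‖b‖ ^ 2 - ‖a‖ ^ 2 := by nlinarith
  have hs2 := Real.sq_sqrt hsq
  have hs0 := Real.sqrt_nonneg (‖b‖ ^ 2 - ‖a‖ ^ 2)
  -- The larger root of that quadratic. Since `x ≥ 1`, growth would force the value at `1`, of
  -- modulus `2 (‖b‖ - ‖a‖)`, to vanish as well.
  set x : ℝ := (‖b‖ + √(‖b‖ ^ 2 - ‖a‖ ^ 2)) / ‖a‖ with hx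
  have hax : ‖a‖ * x = ‖b‖ + √(‖b‖ ^ 2 - ‖a‖ ^ 2) := by rw [hx]; field_simp
  have hx1 : 1 ≤ x := by rw [hx, le_div_iff₀ ha0]; linarith
  have hroot : ‖a‖ * x ^ 2 - 2 * ‖b‖ * x + ‖a‖ = 0 := by
    have : ‖a‖ * (‖a‖ * x ^ 2 - 2 * ‖b‖ * x + ‖a‖) = 0 := by
      have : (‖a‖ * x - ‖b‖) ^ 2 = ‖b‖ ^ 2 - ‖a‖ ^ 2 := by rw [hax]; linarith [hs2]
      linarith
    exact (mul_eq_zero.mp this).resolve_left ha0.ne'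
  have hg := hgrow u v hu1 hv1 x hx1
  have hone := hval 1
  simp only [Complex.ofReal_one, one_mul] at hone
  rw [hval, hroot, hone, norm_mul, hη1, Complex.norm_real] at hg
  simp only [Complex.ofReal_zero, mul_zero, norm_zero, one_mul, Real.norm_eq_abs, sq_abs] at hg
  have hpos : 0 < x ^ 2 * (‖a‖ * 1 ^ 2 - 2 * ‖b‖ * 1 + ‖a‖) ^ 2 := by
    have : ‖a‖ * 1 ^ 2 - 2 * ‖b‖ * 1 + ‖a‖ ≠ 0 := by
      intro h; linarith
    positivity
  nlinarith

theorem IsUnilossless.scaledResolvent_mul_of_ne_zero {A : Matrix ι ι ℂ} (hA : IsUnilossless A)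
    {w : ι → ℂ} (hw : ∀ k, ‖w k‖ = 1) (hdet : (diagonal w - A).det ≠ 0) {i j : ι} (hij : i ≠ j)
    (ha : scaledResolvent A w i i * scaledResolvent A w j j -
      scaledResolvent A w i j * scaledResolvent A w j i ≠ 0) :
    0 ≤ -(scaledResolvent A w i j * scaledResolvent A w j i) := by
  set t := scaledResolvent A w i i
  set s := scaledResolvent A w j j
  set y := scaledResolvent A w i j * scaledResolvent A w j i with hy
  have hQ : ∀ u v : ℂ,
      (diagonal (Function.update (Function.update w i (u * w i)) j (v * w j)) - A).det =
      (diagonal w - A).det * ((t * s - y) * u * v + (t - (t * s - y)) * u +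
        (s - (t * s - y)) * v + (1 - t - s + (t * s - y))) := by
    intro u v
    rw [det_update_two hdet hij]
    ring
  have hupd : ∀ u v : ℂ, ‖u‖ = 1 → ‖v‖ = 1 → ∀ k,
      ‖Function.update (Function.update w i (u * w i)) j (v * w j) k‖ = 1 := by
    intro u v hu hv k
    simp only [Function.update_apply]
    split_ifs <;> simp [hu, hv, hw]
  have hprod : ∀ u v : ℂ, ∏ k, Function.update (Function.update w i (u * w i)) j (v * w j) k =
      u * v * ∏ k, w k := by
    intro u v
    have : ∀ k, Function.update (Function.update w i (u * w i)) j (v * w j) k =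
        (if k = i then u else 1) * (if k = j then v else 1) * w k := by
      intro k
      simp only [Function.update_apply]
      split_ifs <;> simp_all
    simp only [this, Finset.prod_mul_distrib, Finset.prod_ite_eq', Finset.mem_univ, if_true]
  have hself : ∀ u v : ℂ, ‖u‖ = 1 → ‖v‖ = 1 →
      (t * s - y) * u * v + (t - (t * s - y)) * u + (s - (t * s - y)) * v +
          (1 - t - s + (t * s - y)) =
        u * v * (starRingEnd ℂ) ((t * s - y) * u * v + (t - (t * s - y)) * u +
          (s - (t * s - y)) * v + (1 - t - s + (t * s - y))) := by
    intro u v hu hv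
    have h1 := hA.det_eq_conj hw
    have h2 := hA.det_eq_conj (hupd u v hu hv)
    rw [hQ, hprod, map_mul] at h2
    refine mul_left_cancel₀ hdet (h2.trans ?_)
    set q := (starRingEnd ℂ) ((t * s - y) * u * v + (t - (t * s - y)) * u +
        (s - (t * s - y)) * v + (1 - t - s + (t * s - y)))
    linear_combination -u * v * q * h1
  have hgrow : ∀ u v : ℂ, ‖u‖ = 1 → ‖v‖ = 1 → ∀ x : ℝ, 1 ≤ x →
      x ^ 2 * ‖(t * s - y) * u * v + (t - (t * s - y)) * u + (s - (t * s - y)) * v +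
          (1 - t - s + (t * s - y))‖ ^ 2 ≤
        ‖(t * s - y) * (x * u) * (x * v) + (t - (t * s - y)) * (x * u) +
          (s - (t * s - y)) * (x * v) + (1 - t - s + (t * s - y))‖ ^ 2 := by
    intro u v hu hv x hx
    have h := hA.norm_det_ge hij hx (hupd u v hu hv)
    have hfun : (fun k => ((if k = i ∨ k = j then x else 1 : ℝ) : ℂ) *
        Function.update (Function.update w i (u * w i)) j (v * w j) k) =
        Function.update (Function.update w i (x * u * w i)) j (x * v * w j) := by
      ext k
      simp only [Function.update_apply]
      split_ifs <;> simp_all [mul_assoc]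
    rw [hfun, hQ, hQ, norm_mul, norm_mul, mul_pow, mul_pow] at h
    have hpos : 0 < ‖(diagonal w - A).det‖ ^ 2 := by positivity
    refine le_of_mul_le_mul_left ?_ hpos
    linarith
  obtain ⟨hd, hc, hle⟩ := norm_le_of_biaffine_growth hself hgrow ha
  -- This is `a d - b c` for the bi-affine coefficients, which equals `‖a‖ ^ 2 - ‖b‖ ^ 2` by
  -- self-inversiveness.
  have h1 : -y = (t * s - y) * (1 - t - s + (t * s - y)) -
      (t - (t * s - y)) * (s - (t * s - y)) := by ring
  rw [h1, hd, hc, Complex.mul_conj', Complex.mul_conj', ← Complex.ofReal_pow,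
    ← Complex.ofReal_pow, ← Complex.ofReal_sub, Complex.zero_le_real]
  nlinarith [norm_nonneg (t - (t * s - y))]

/-- The matrix `diag(X) - A` over the polynomial ring. -/
noncomputable def pencil (A : Matrix ι ι ℂ) : Matrix ι ι (MvPolynomial ι ℂ) :=
  diagonal MvPolynomial.X - A.map MvPolynomial.C

theorem map_eval_pencil (A : Matrix ι ι ℂ) (w : ι → ℂ) :
    (MvPolynomial.eval w).mapMatrix (pencil A) = diagonal w - A := by
  ext i j
  by_cases h : i = j <;> simp [pencil, h, diagonal]

theorem eval_det_pencil (A : Matrix ι ι ℂ) (w : ι → ℂ) :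
    MvPolynomial.eval w (pencil A).det = (diagonal w - A).det := by
  rw [RingHom.map_det, map_eval_pencil]

theorem eval_adjugate_pencil (A : Matrix ι ι ℂ) (w : ι → ℂ) (i j : ι) :
    MvPolynomial.eval w ((pencil A).adjugate i j) = (diagonal w - A).adjugate i j := by
  rw [← map_eval_pencil A w, ← RingHom.map_adjugate]
  rfl

/-- At infinity `diag w` dominates `A`: the same minor for `1 - s • A` is `1` at `s = 0`, hence
nonzero at some `s ≠ 0`, and `w = s⁻¹` is then a nonzero value. -/
theorem pencil_minor_ne_zero (A : Matrix ι ι ℂ) {i j : ι} (hij : i ≠ j) :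
    (pencil A).adjugate i i * (pencil A).adjugate j j -
      (pencil A).adjugate i j * (pencil A).adjugate j i ≠ 0 := by
  intro h0
  have hcont : Continuous fun s : ℂ => (1 - s • A).adjugate i i * (1 - s • A).adjugate j j -
      (1 - s • A).adjugate i j * (1 - s • A).adjugate j i := by fun_prop
  have hev := hcont.continuousAt.eventually_ne (x := 0) (y := 0) (by simp [hij])
  obtain ⟨s, hs, hs0⟩ := ((hev.filter_mono nhdsWithin_le_nhds).and
    (self_mem_nhdsWithin : {0}ᶜ ∈ 𝓝[≠] (0 : ℂ))).exists
  have hs0 : s ≠ 0 := hs0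
  refine hs ?_
  have h1 := congrArg (MvPolynomial.eval fun _ => s⁻¹) h0
  simp only [map_sub, map_mul, eval_adjugate_pencil, map_zero] at h1
  have h2 : 1 - s • A = s • (diagonal (fun _ => s⁻¹) - A) := by
    rw [smul_sub, ← smul_one_eq_diagonal, smul_smul, mul_inv_cancel₀ hs0, one_smul]
  rw [h2, adjugate_smul]
  simp only [Matrix.smul_apply, smul_eq_mul]
  linear_combination (s ^ (Fintype.card ι - 1)) ^ 2 * h1

theorem pencil_det_ne_zero (A : Matrix ι ι ℂ) : (pencil A).det ≠ 0 := by
  intro h0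
  refine A.charpoly_monic.ne_zero (Polynomial.funext fun z => ?_)
  have h1 := congrArg (MvPolynomial.eval fun _ => z) h0
  rw [eval_det_pencil, map_zero] at h1
  rw [Matrix.eval_charpoly, eval_zero, ← h1]
  rfl

/-- Removes the nondegeneracy hypothesis of `scaledResolvent_mul_of_ne_zero` by density. -/
theorem IsUnilossless.scaledResolvent_mul {A : Matrix ι ι ℂ} (hA : IsUnilossless A)
    {w : ι → ℂ} (hw : ∀ k, ‖w k‖ = 1) (hdet : (diagonal w - A).det ≠ 0) {i j : ι} (hij : i ≠ j) :
    0 ≤ -(scaledResolvent A w i j * scaledResolvent A w j i) := by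
  -- Clearing denominators by the positive factor `‖det‖ ^ 4` gives an expression continuous
  -- everywhere, so the sign condition is closed.
  have hrel : ∀ v : ι → ℂ, (diagonal v - A).det ≠ 0 →
      -(v i * v j * (diagonal v - A).adjugate i j * (diagonal v - A).adjugate j i *
        (starRingEnd ℂ) (diagonal v - A).det ^ 2) =
      ((‖(diagonal v - A).det‖ ^ 4 : ℝ) : ℂ) *
        -(scaledResolvent A v i j * scaledResolvent A v j i) := by
    intro v hv
    rw [scaledResolvent_apply_eq_div, scaledResolvent_apply_eq_div]
    have h4 : ((‖(diagonal v - A).det‖ ^ 4 : ℝ) : ℂ) =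
        ((diagonal v - A).det * (starRingEnd ℂ) (diagonal v - A).det) ^ 2 := by
      rw [Complex.mul_conj']
      push_cast
      ring
    rw [h4]
    field_simp
  have hclosed : IsClosed {v : ι → ℂ |
      0 ≤ -(v i * v j * (diagonal v - A).adjugate i j * (diagonal v - A).adjugate j i *
        (starRingEnd ℂ) (diagonal v - A).det ^ 2)} := by
    refine isClosed_le continuous_const ?_
    have := continuous_det_diagonal_sub A
    have h2 := Complex.continuous_conj.comp this
    have h3 : Continuous fun v : ι → ℂ => (diagonal v - A).adjugate := by fun_prop
    have h4 := h3.matrix_elem i j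
    have h5 := h3.matrix_elem j i
    exact (((((continuous_apply i).mul (continuous_apply j)).mul h4).mul h5).mul (h2.pow 2)).neg
  have hmem := closure_minimal (s := {v : ι → ℂ | (∀ k, ‖v k‖ = 1) ∧ MvPolynomial.eval v
      ((pencil A).det * ((pencil A).adjugate i i * (pencil A).adjugate j j -
      (pencil A).adjugate i j * (pencil A).adjugate j i)) ≠ 0}) ?_ hclosed
      (mem_closure_torus_eval_ne_zero
        (mul_ne_zero (pencil_det_ne_zero A) (pencil_minor_ne_zero A hij)) hw)
  · rw [Set.mem_ofPred_eq, hrel w hdet] at hmem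
    have hpos : (0 : ℂ) < ((‖(diagonal w - A).det‖ ^ 4 : ℝ) : ℂ) := by
      rw [Complex.zero_lt_real]; positivity
    exact le_of_mul_le_mul_left (by simpa using hmem) hpos
  · rintro v ⟨hv, hne⟩
    simp only [map_sub, map_mul, eval_adjugate_pencil, eval_det_pencil] at hne
    have hvdet := left_ne_zero_of_mul hne
    have hv0 : ∀ k, v k ≠ 0 := fun k => norm_pos_iff.mp (by rw [hv]; norm_num)
    rw [Set.mem_ofPred_eq, hrel v hvdet]
    refine mul_nonneg (Complex.zero_le_real.mpr (by positivity))
      (hA.scaledResolvent_mul_of_ne_zero hv hvdet hij ?_)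
    simp only [scaledResolvent_apply_eq_div]
    intro h0
    refine right_ne_zero_of_mul hne ?_
    have := hv0 i
    have := hv0 j
    field_simp at h0
    simpa [hv0] using h0

/-! ### Changing one coordinate, and irreducibility -/

/-- The Sherman–Morrison formula with the denominator cleared. -/
theorem scaledResolvent_update {A : Matrix ι ι ℂ} {w : ι → ℂ} {k : ι} {u : ℂ}
    (hdet : (diagonal w - A).det ≠ 0)
    (hdet' : (diagonal (Function.update w k (u * w k)) - A).det ≠ 0) {i : ι} (hik : i ≠ k) (j : ι) :
    scaledResolvent A (Function.update w k (u * w k)) i j *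
        (1 + (u - 1) * scaledResolvent A w k k) =
      scaledResolvent A w i j * (1 + (u - 1) * scaledResolvent A w k k) -
        (u - 1) * (scaledResolvent A w i k * scaledResolvent A w k j) := by
  set M := diagonal w - A
  set M' := diagonal (Function.update w k (u * w k)) - A
  have hdiff : M' - M = diagonal (Pi.single k ((u - 1) * w k)) := by
    rw [sub_sub_sub_cancel_right, diagonal_sub]
    congr 1
    ext l
    rcases eq_or_ne l k with rfl | h
    · simp; ring
    · simp [h]
  have hres : M⁻¹ - M'⁻¹ = M'⁻¹ * (M' - M) * M⁻¹ := by
    rw [mul_sub, sub_mul, nonsing_inv_mul _ (isUnit_iff_ne_zero.mpr hdet'), one_mul, mul_assoc,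
      mul_nonsing_inv _ (isUnit_iff_ne_zero.mpr hdet), mul_one]
  have hentry : ∀ l, M⁻¹ i l - M'⁻¹ i l = M'⁻¹ i k * ((u - 1) * w k) * M⁻¹ k l := by
    intro l
    have := congrFun (congrFun hres i) l
    rw [hdiff, Matrix.sub_apply, Matrix.mul_apply] at this
    rw [this, Finset.sum_eq_single k]
    · rw [mul_diagonal, Pi.single_eq_same]
    · intro b _ hb
      rw [mul_diagonal, Pi.single_eq_of_ne hb, mul_zero, zero_mul]
    · simp
  simp only [scaledResolvent_apply, Function.update_of_ne hik]
  have h1 := hentry j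
  have h2 := hentry k
  linear_combination (-w i * (1 + (u - 1) * w k * M⁻¹ k k)) * h1 +
    w i * (u - 1) * w k * M⁻¹ k j * h2

theorem exists_torus_eval_ne_zero {κ : Type*} {q : MvPolynomial κ ℂ} (hq : q ≠ 0) :
    ∃ w : κ → ℂ, (∀ k, ‖w k‖ = 1) ∧ MvPolynomial.eval w q ≠ 0 :=
  closure_nonempty_iff.mp ⟨_, mem_closure_torus_eval_ne_zero hq (w := fun _ => 1) (by simp)⟩

/-- If the `(i, j)` entry of the resolvent vanished identically, changing `w k` alone would leave
the correction term `T i k * T k j` equal to zero. -/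
theorem pencil_adjugate_trans (A : Matrix ι ι ℂ) {i j k : ι}
    (hik : (pencil A).adjugate i k ≠ 0) (hkj : (pencil A).adjugate k j ≠ 0) :
    (pencil A).adjugate i j ≠ 0 := by
  rcases eq_or_ne i k with rfl | hne
  · exact hkj
  intro h0
  obtain ⟨w, hw, hev⟩ := exists_torus_eval_ne_zero
    (mul_ne_zero (pencil_det_ne_zero A) (mul_ne_zero hik hkj))
  simp only [map_mul, eval_det_pencil, eval_adjugate_pencil] at hev
  have hdet := left_ne_zero_of_mul hev
  have hik' := left_ne_zero_of_mul (right_ne_zero_of_mul hev)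
  have hkj' := right_ne_zero_of_mul (right_ne_zero_of_mul hev)
  have hw0 : ∀ l, w l ≠ 0 := fun l => norm_pos_iff.mp (by rw [hw]; norm_num)
  have hz : ∀ v : ι → ℂ, scaledResolvent A v i j = 0 := by
    intro v
    rw [scaledResolvent_apply_eq_div, ← eval_adjugate_pencil, h0]
    simp
  obtain ⟨u, hu, hu1⟩ : ∃ u : ℂ, 1 + (u - 1) * scaledResolvent A w k k ≠ 0 ∧ u - 1 ≠ 0 := by
    by_cases h : 1 + scaledResolvent A w k k = 0
    · refine ⟨3, fun h' => ?_, by norm_num⟩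
      have : (1 : ℂ) = 0 := by linear_combination 2 * h - h'
      exact one_ne_zero this
    · refine ⟨2, fun h' => h ?_, by norm_num⟩
      linear_combination h'
  have hdet' : (diagonal (Function.update w k (u * w k)) - A).det ≠ 0 := by
    rw [det_update_one hdet]
    exact mul_ne_zero hdet hu
  have h := scaledResolvent_update hdet hdet' hne j
  rw [hz, hz, zero_mul, zero_sub, eq_comm, neg_eq_zero] at h
  simp [hu1, scaledResolvent_apply_eq_div, hw0, hdet, hik', hkj'] at h

theorem isReducible_iff {κ : Type*} [Fintype κ] (A : Matrix κ κ ℂ) :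
    IsReducible A ↔
      ∃ s : Set κ, s.Nonempty ∧ sᶜ.Nonempty ∧ ∀ i ∈ s, ∀ j ∉ s, A i j = 0 := by
  classical
  constructor
  · rintro ⟨p, q, σ, E, G, F, hp, hq, hA⟩
    refine ⟨Set.range (σ ∘ Sum.inr), ⟨_, ⟨0, hq⟩, rfl⟩, ⟨σ (Sum.inl ⟨0, hp⟩), ?_⟩, ?_⟩
    · rintro ⟨x, hx⟩
      simpa using σ.injective hx
    · rintro _ ⟨x, rfl⟩ j hj
      obtain ⟨y, rfl⟩ := σ.surjective j
      rcases y with y | y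
      · simpa using congrFun (congrFun hA (Sum.inr x)) (Sum.inl y)
      · exact absurd ⟨y, rfl⟩ hj
  · rintro ⟨s, ⟨i, hi⟩, ⟨j, hj⟩, hA⟩
    let e₁ := (Fintype.equivFin {x // x ∉ s}).symm
    let e₂ := (Fintype.equivFin {x // ¬ x ∉ s}).symm
    let σ := (Equiv.sumCongr e₁ e₂).trans (Equiv.sumCompl fun x => x ∉ s)
    refine ⟨_, _, σ, (A.submatrix σ σ).toBlocks₁₁, (A.submatrix σ σ).toBlocks₁₂,
      (A.submatrix σ σ).toBlocks₂₂, Fintype.card_pos_iff.mpr ⟨⟨j, hj⟩⟩,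
      Fintype.card_pos_iff.mpr ⟨⟨i, not_not.mpr hi⟩⟩, ?_⟩
    rw [← fromBlocks_toBlocks (A.submatrix σ σ)]
    congr 1
    ext x y
    exact hA _ (not_not.mp (e₂ x).2) _ (e₁ y).2

/-- By transitivity, the indices reached from `i` through nonzero entries form a set that makes the
resolvent block triangular. The inverse of the resolvent, and hence `A`, has the same shape. -/
theorem pencil_adjugate_ne_zero {A : Matrix ι ι ℂ} (hA : ¬ IsReducible A) {i j : ι}
    (hij : i ≠ j) : (pencil A).adjugate i j ≠ 0 := by
  classical
  intro h0
  refine hA ((isReducible_iff A).mpr ⟨{k | k = i ∨ (pencil A).adjugate i k ≠ 0}, ⟨i, Or.inl rfl⟩,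
    ⟨j, ?_⟩, ?_⟩)
  · rintro (h | h)
    · exact hij h.symm
    · exact h h0
  set J : Set ι := {k | k = i ∨ (pencil A).adjugate i k ≠ 0} with hJ
  obtain ⟨w, -, hdet⟩ := exists_torus_eval_ne_zero (pencil_det_ne_zero A)
  rw [eval_det_pencil] at hdet
  let b : ι → ℕ := fun k => if k ∈ J then 1 else 0
  have hlt : ∀ k l, b l < b k ↔ k ∈ J ∧ l ∉ J := by
    intro k l
    by_cases hk : k ∈ J <;> by_cases hl : l ∈ J <;> simp [b, hk, hl]
  have hzero : ∀ k ∈ J, ∀ l ∉ J, (pencil A).adjugate k l = 0 := by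
    intro k hk l hl
    by_contra hkl
    refine hl (Or.inr ?_)
    rcases hk with rfl | hk
    · exact hkl
    · exact pencil_adjugate_trans A hk hkl
  have htri : (diagonal w - A)⁻¹.BlockTriangular b := by
    intro k l hkl
    rw [hlt] at hkl
    rw [Matrix.inv_def, Matrix.smul_apply, ← eval_adjugate_pencil, hzero k hkl.1 l hkl.2]
    simp
  have hunit := isUnit_iff_ne_zero.mpr hdet
  let _ := invertibleOfIsUnitDet _ ((isUnit_nonsing_inv_det_iff).mpr hunit)
  have hinv := blockTriangular_inv_of_blockTriangular htri
  rw [nonsing_inv_nonsing_inv _ hunit] at hinv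
  intro k hk l hl
  have h := hinv ((hlt k l).mpr ⟨hk, hl⟩)
  have hkl : k ≠ l := by
    rintro rfl
    exact hl hk
  simpa [hkl] using h

/-! ### The three-cycle identity -/

/-- The expression is a nonnegative real quadratic in `τ`. Real coefficients make `p s + q r`
imaginary; its discriminant is `-(p s - q r) ^ 2 ≤ 0`, which makes `p s - q r` real. -/
theorem mul_eq_neg_conj_of_nonneg {p q r s : ℂ}
    (h : ∀ τ : ℝ, 0 ≤ -((p + Complex.I * τ * q) * (r + Complex.I * τ * s))) :
    q * r = -(starRingEnd ℂ) (p * s) := by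
  have h0 := h 0
  have h1 := h 1
  have h2 := h (-1)
  simp only [Complex.ofReal_zero, mul_zero, zero_mul, add_zero, Complex.ofReal_one, mul_one,
    Complex.ofReal_neg, mul_neg] at h0 h1 h2
  rw [Complex.nonneg_iff] at h0 h1 h2
  have hα : -(p * r) = ((-(p * r)).re : ℂ) := Complex.ext (by simp) (by simpa using h0.2.symm)
  have hγ : q * s = ((q * s).re : ℂ) := by
    refine Complex.ext (by simp) ?_
    have e : q * s = (-((p + Complex.I * q) * (r + Complex.I * s)) +
        -((p + -Complex.I * q) * (r + -Complex.I * s))) / 2 + p * r := by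
      linear_combination (q * s) * Complex.I_sq
    have e' := congrArg Complex.im e
    simp only [Complex.add_im, Complex.div_ofNat_im] at e'
    rw [Complex.ofReal_im, e', ← h1.2, ← h2.2]
    have := h0.2
    rw [Complex.neg_im] at this
    linarith
  have hβ : -Complex.I * (p * s + q * r) = ((-Complex.I * (p * s + q * r)).re : ℂ) := by
    refine Complex.ext (by simp) ?_
    have e : -Complex.I * (p * s + q * r) = (-((p + Complex.I * q) * (r + Complex.I * s)) -
        -((p + -Complex.I * q) * (r + -Complex.I * s))) / 2 := by ring
    have e' := congrArg Complex.im e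
    simp only [Complex.sub_im, Complex.div_ofNat_im] at e'
    rw [Complex.ofReal_im, e', ← h1.2, ← h2.2]
    simp
  set α := (-(p * r)).re
  set β := (-Complex.I * (p * s + q * r)).re
  set γ := (q * s).re
  have hdisc : discrim γ β α ≤ 0 := by
    refine discrim_le_zero fun τ => ?_
    have hτ := h τ
    have e : -((p + Complex.I * τ * q) * (r + Complex.I * τ * s)) =
        ((γ * (τ * τ) + β * τ + α : ℝ) : ℂ) := by
      push_cast
      rw [← hα, ← hβ, ← hγ]
      linear_combination (-(τ : ℂ) ^ 2 * q * s) * Complex.I_sq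
    rw [e, Complex.zero_le_real] at hτ
    exact hτ
  have hsq : (p * s - q * r) ^ 2 = ((-discrim γ β α : ℝ) : ℂ) := by
    rw [discrim]
    push_cast
    rw [← hα, ← hβ, ← hγ]
    linear_combination (p * s + q * r) ^ 2 * Complex.I_sq
  have hre : (p * s - q * r).im = 0 := by
    have h1 := congrArg Complex.re hsq
    have h2 := congrArg Complex.im hsq
    rw [sq, Complex.mul_re, Complex.ofReal_re] at h1
    rw [sq, Complex.mul_im, Complex.ofReal_im] at h2
    set a := (p * s - q * r).re
    set b := (p * s - q * r).im
    by_contra hb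
    have ha : a = 0 := by
      have : a * b = 0 := by linarith
      exact (mul_eq_zero.mp this).resolve_right hb
    have : 0 < b * b := mul_self_pos.mpr hb
    rw [ha] at h1
    linarith
  have him : (p * s + q * r).re = 0 := by
    have h1 := congrArg Complex.im hβ
    simp only [Complex.mul_im, Complex.neg_re, Complex.neg_im, Complex.I_re, Complex.I_im,
      Complex.ofReal_im] at h1
    linarith
  rw [Complex.sub_im] at hre
  rw [Complex.add_re] at him
  refine Complex.ext ?_ ?_
  · rw [Complex.neg_re, Complex.conj_re]
    linarith
  · rw [Complex.neg_im, Complex.conj_im]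
    linarith

theorem IsUnilossless.scaledResolvent_cycle {A : Matrix ι ι ℂ} (hA : IsUnilossless A)
    {w : ι → ℂ} (hw : ∀ k, ‖w k‖ = 1) (hdet : (diagonal w - A).det ≠ 0) {i j k : ι} (hij : i ≠ j)
    (hik : i ≠ k) (hjk : j ≠ k) :
    scaledResolvent A w i k * scaledResolvent A w k j * scaledResolvent A w j i =
      -(starRingEnd ℂ) (scaledResolvent A w i j *
        (scaledResolvent A w j k * scaledResolvent A w k i)) := by
  refine mul_eq_neg_conj_of_nonneg fun τ => ?_
  have hdiag := hA.scaledResolvent_diag hw hdet k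
  set t := scaledResolvent A w k k
  -- Since `Re t = 1/2`, `conj δ = δ - I τ`. The unimodular `u = conj δ / δ` gives `1 + (u - 1) t =
  -- 1 / δ`, so the update of `T` becomes affine in the real parameter `τ`.
  set δ : ℂ := 1 + Complex.I * τ * t with hδ
  have hδ0 : δ ≠ 0 := by
    intro h
    have hc := congrArg (starRingEnd ℂ) h
    simp only [hδ, map_add, map_mul, map_one, Complex.conj_I, Complex.conj_ofReal, map_zero] at hc
    have hτ : Complex.I * τ = 0 := by
      linear_combination h - hc - Complex.I * τ * hdiag
    rw [hδ, hτ] at h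
    simp at h
  have hconj : (starRingEnd ℂ) δ = δ - Complex.I * τ := by
    simp only [hδ, map_add, map_mul, map_one, Complex.conj_I, Complex.conj_ofReal]
    linear_combination -Complex.I * τ * hdiag
  set u : ℂ := (starRingEnd ℂ) δ / δ with hu
  have hu1 : ‖u‖ = 1 := by
    rw [hu, norm_div, RCLike.norm_conj, div_self (norm_ne_zero_iff.mpr hδ0)]
  have huδ : (u - 1) * δ = -(Complex.I * τ) := by
    rw [hu, hconj]
    field_simp
    ring
  have hone : (1 + (u - 1) * t) * δ = 1 := by
    linear_combination t * huδ + hδ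
  have hne : 1 + (u - 1) * t ≠ 0 := left_ne_zero_of_mul (hone ▸ one_ne_zero)
  have hdet' : (diagonal (Function.update w k (u * w k)) - A).det ≠ 0 := by
    rw [det_update_one hdet]
    exact mul_ne_zero hdet hne
  have hupd : ∀ {a : ι}, a ≠ k → ∀ b, scaledResolvent A (Function.update w k (u * w k)) a b =
      scaledResolvent A w a b + Complex.I * τ * (scaledResolvent A w a k *
        scaledResolvent A w k b) := by
    intro a ha b
    have h := scaledResolvent_update hdet hdet' ha b
    linear_combination δ * h - (scaledResolvent A (Function.update w k (u * w k)) a b) * hone +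
      (scaledResolvent A w a b) * hone - (scaledResolvent A w a k * scaledResolvent A w k b) * huδ
  have h := hA.scaledResolvent_mul (norm_update_mul hw k hu1) hdet' hij
  rwa [hupd hik, hupd hjk] at h

/-! ### Construction of the invariant diagonal matrix -/

/-- Weights are fixed by comparison with the base index `o`; their positivity is the sign condition,
and the cycle identity through `o` makes them consistent for every other pair. -/
theorem exists_scaling_of_irreducible {A : Matrix ι ι ℂ} (hA : IsUnilossless A)
    {w : ι → ℂ} (hw : ∀ k, ‖w k‖ = 1) (hdet : (diagonal w - A).det ≠ 0)
    (hne : ∀ i j, i ≠ j → scaledResolvent A w i j ≠ 0) (o : ι) :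
    ∃ g : ι → ℝ, (∀ i, 0 < g i) ∧ ∀ i j, i ≠ j →
      (starRingEnd ℂ) (scaledResolvent A w i j) * g i = -(g j * scaledResolvent A w j i) := by
  set T := scaledResolvent A w
  have hreal : ∀ i j, i ≠ j → (starRingEnd ℂ) (T i j) * (starRingEnd ℂ) (T j i) =
      T i j * T j i := by
    intro i j hij
    have h := (Complex.nonneg_iff.mp (hA.scaledResolvent_mul hw hdet hij)).2
    rw [← map_mul, Complex.conj_eq_iff_im]
    rw [Complex.neg_im] at h
    linarith
  have hconj0 : ∀ i j, i ≠ j → (starRingEnd ℂ) (T i j) ≠ 0 := fun i j hij => by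
    simpa using hne i j hij
  have hg : ∀ i, ∃ g : ℝ, 0 < g ∧ (i = o → g = 1) ∧
      (i ≠ o → (g : ℂ) * (starRingEnd ℂ) (T i o) = -T o i) := by
    intro i
    by_cases hio : i = o
    · exact ⟨1, one_pos, fun _ => rfl, fun h => absurd hio h⟩
    have hnn := hA.scaledResolvent_mul hw hdet hio
    have hpos : 0 < -(T i o * T o i) := lt_of_le_of_ne hnn
      (neg_ne_zero.mpr (mul_ne_zero (hne _ _ hio) (hne _ _ (Ne.symm hio)))).symm
    rw [Complex.pos_iff] at hpos
    have hn : 0 < ‖T i o‖ := norm_pos_iff.mpr (hne _ _ hio)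
    have hn' : (‖T i o‖ : ℂ) ≠ 0 := by exact_mod_cast hn.ne'
    refine ⟨(-(T i o * T o i)).re / ‖T i o‖ ^ 2, div_pos hpos.1 (by positivity),
      fun h => absurd h hio, fun _ => ?_⟩
    have e : (((-(T i o * T o i)).re : ℝ) : ℂ) = -(T i o * T o i) :=
      Complex.ext (by simp) (by simpa using hpos.2)
    push_cast
    rw [e]
    field_simp
    linear_combination (-T o i) * Complex.mul_conj' (T i o)
  choose g hg0 hgo hgi using hg
  refine ⟨g, hg0, fun i j hij => ?_⟩
  by_cases hjo : j = o
  · subst hjo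
    rw [hgo j rfl, Complex.ofReal_one, one_mul, mul_comm]
    exact hgi i hij
  by_cases hio : i = o
  · subst hio
    rw [hgo i rfl, Complex.ofReal_one, mul_one]
    refine mul_right_cancel₀ (hconj0 j i hjo) ?_
    linear_combination hreal i j hij + T j i * hgi j hjo
  have hi := hgi i hio
  have hj := hgi j hjo
  have hcyc := hA.scaledResolvent_cycle hw hdet hij hio hjo
  rw [map_mul, map_mul] at hcyc
  have hr := hreal i o hio
  have c1 := hconj0 i o hio
  have c2 := hconj0 j o hjo
  have c3 := hne i o hio
  refine mul_right_cancel₀ (mul_ne_zero (mul_ne_zero c1 c2) c3) ?_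
  change T i o * T o j * T j i = _ at hcyc
  linear_combination (starRingEnd ℂ) (T i j) * (starRingEnd ℂ) (T j o) * T i o * hi +
    T j i * (starRingEnd ℂ) (T i o) * T i o * hj + (starRingEnd ℂ) (T i j) *
    (starRingEnd ℂ) (T j o) * hr - (starRingEnd ℂ) (T i o) * hcyc

theorem IsUnilossless.hasPositiveDiagonalInvariant {A : Matrix ι ι ℂ} (hA : IsUnilossless A)
    (hirr : ¬ IsReducible A) : HasPositiveDiagonalInvariant A := by
  rcases isEmpty_or_nonempty ι with hι | ⟨⟨o⟩⟩
  · exact ⟨fun _ => 1, fun _ => one_pos, Subsingleton.elim _ _⟩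
  obtain ⟨w, hw, hev⟩ := exists_torus_eval_ne_zero (mul_ne_zero (pencil_det_ne_zero A)
    (Finset.prod_ne_zero_iff.mpr fun (ij : ι × ι) (h : ij ∈ Finset.univ.filter fun ij => ij.1 ≠ ij.2)
      => pencil_adjugate_ne_zero hirr (Finset.mem_filter.mp h).2))
  rw [map_mul, map_prod, eval_det_pencil] at hev
  have hdet := left_ne_zero_of_mul hev
  have hw0 : ∀ l, w l ≠ 0 := fun l => norm_pos_iff.mp (by rw [hw]; norm_num)
  have hne : ∀ i j, i ≠ j → scaledResolvent A w i j ≠ 0 := by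
    intro i j hij
    have h := Finset.prod_ne_zero_iff.mp (right_ne_zero_of_mul hev) (i, j) (by simpa using hij)
    rw [eval_adjugate_pencil] at h
    rw [scaledResolvent_apply_eq_div]
    exact div_ne_zero (mul_ne_zero (hw0 i) h) hdet
  obtain ⟨g, hg, hgT⟩ := exists_scaling_of_irreducible hA hw hdet hne o
  set T := scaledResolvent A w with hT
  set G : Matrix ι ι ℂ := diagonal fun i => (g i : ℂ) with hG
  set W : Matrix ι ι ℂ := diagonal w with hW
  -- The diagonal uses `Re (T i i) = 1/2`, the rest the scaling relation. Multiplying by `(W - A)ᴴ`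
  -- and `W - A` turns it into `Aᴴ G A = Wᴴ G W`.
  have hlyap : Tᴴ * G + G * T = G := by
    ext j i
    rw [Matrix.add_apply, hG, mul_diagonal, diagonal_mul, conjTranspose_apply]
    rcases eq_or_ne i j with rfl | hij
    · rw [diagonal_apply_eq]
      have h := hA.scaledResolvent_diag hw hdet i
      change star (T i i) * _ + _ = _
      change T i i + star (T i i) = 1 at h
      linear_combination (g i : ℂ) * h
    · rw [diagonal_apply_ne _ hij.symm]
      have h := hgT i j hij
      change star (T i j) * _ = _ at h
      rw [h]
      ring
  have hTM : T * (W - A) = W := by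
    rw [hT, scaledResolvent, mul_assoc, nonsing_inv_mul _ (isUnit_iff_ne_zero.mpr hdet), mul_one]
  have hTM' : (W - A)ᴴ * Tᴴ = Wᴴ := by rw [← conjTranspose_mul, hTM]
  have hWGW : Wᴴ * G * W = G := by
    rw [hW, hG, diagonal_conjTranspose, diagonal_mul_diagonal, diagonal_mul_diagonal]
    congr 1
    ext i
    have h : star (w i) * w i = 1 := by
      have := Complex.conj_mul' (w i)
      rw [hw] at this
      simpa using this
    rw [Pi.star_apply]
    linear_combination (g i : ℂ) * h
  have hexp : Wᴴ * G * (W - A) + (W - A)ᴴ * G * W = (W - A)ᴴ * G * (W - A) := by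
    calc _ = (W - A)ᴴ * (Tᴴ * G + G * T) * (W - A) := by
          rw [mul_add, add_mul, ← hTM', ← mul_assoc, ← mul_assoc, mul_assoc _ T, hTM, hTM']
      _ = _ := by rw [hlyap]
  have hAGA : Aᴴ * G * A = G := by
    rw [conjTranspose_sub] at hexp
    have h : Aᴴ * G * A = Wᴴ * G * W := by
      rw [← sub_eq_zero] at hexp ⊢
      rw [← neg_eq_zero, ← hexp]
      noncomm_ring
    rw [h, hWGW]
  have hGinv : (diagonal fun i => ((g i)⁻¹ : ℂ)) * G = 1 := by
    rw [hG, diagonal_mul_diagonal, ← diagonal_one]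
    congr 1
    ext i
    exact inv_mul_cancel₀ (by exact_mod_cast (hg i).ne')
  have hGinv' := mul_eq_one_comm.mp hGinv
  refine ⟨fun i => (g i)⁻¹, fun i => inv_pos.mpr (hg i), ?_⟩
  simp only [Complex.ofReal_inv]
  set H : Matrix ι ι ℂ := diagonal fun i => ((g i)⁻¹ : ℂ)
  have h1 : (H * Aᴴ * G) * A = 1 := by
    rw [mul_assoc, mul_assoc, ← mul_assoc Aᴴ, hAGA, hGinv]
  have h2 : A * (H * Aᴴ * G) = 1 := mul_eq_one_comm.mp h1
  calc A * H * Aᴴ = (A * (H * Aᴴ * G)) * H := by simp only [mul_assoc, hGinv', mul_one]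
    _ = H := by rw [h2, one_mul]

/-! ### Block triangular forms -/

theorem genCharpoly_eq_prod_blocks {A : Matrix ι ι ℂ} {k : ℕ} {b : ι → Fin k}
    (hb : A.BlockTriangular b) (m : ι → ℕ) :
    genCharpoly A m = ∏ c, genCharpoly (A.toSquareBlock b c) fun i => m i := by
  have htri : (diagonal (fun i => (X : ℂ[X]) ^ m i) - A.map C).BlockTriangular b :=
    (blockTriangular_diagonal _).sub fun i j hij => by simp [hb hij]
  rw [genCharpoly, htri.det_fintype]
  refine Finset.prod_congr rfl fun c _ => ?_
  rw [genCharpoly]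
  congr 1
  ext1 i j
  simp [toSquareBlock_def, diagonal_apply, Subtype.ext_iff]

theorem IsUnilossless.toSquareBlock {A : Matrix ι ι ℂ} (hA : IsUnilossless A) {k : ℕ}
    {b : ι → Fin k} (hb : A.BlockTriangular b) (c : Fin k) :
    IsUnilossless (A.toSquareBlock b c) := by
  intro m hm z hz
  -- Outside the block any positive delay would do.
  let m' : ι → ℕ := fun i => if h : b i = c then m ⟨i, h⟩ else 1
  have hm' : ∀ i, 1 ≤ m' i := by
    intro i
    by_cases h : b i = c
    · simpa [m', h] using hm ⟨i, h⟩
    · simp [m', h]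
  refine hA m' hm' z ?_
  rw [genCharpoly_eq_prod_blocks hb, IsRoot.def, eval_prod]
  refine Finset.prod_eq_zero (Finset.mem_univ c) ?_
  have : (fun i : {i // b i = c} => m' i) = m := by
    ext i
    simp [m', i.2]
  rw [this]
  exact hz

theorem isUnilossless_of_blocks {A : Matrix ι ι ℂ} {k : ℕ} {b : ι → Fin k}
    (hb : A.BlockTriangular b) (h : ∀ c, IsUnilossless (A.toSquareBlock b c)) :
    IsUnilossless A := by
  intro m hm z hz
  rw [genCharpoly_eq_prod_blocks hb, IsRoot.def, eval_prod, Finset.prod_eq_zero_iff] at hz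
  obtain ⟨c, -, hc⟩ := hz
  exact h c _ (fun i => hm i) z hc

/-- Splitting a reducible diagonal block yields a block triangular form with one more block. -/
theorem exists_refinement_of_isReducible {κ : Type*} [Fintype κ] {A : Matrix κ κ ℂ} {k : ℕ}
    {b : κ → Fin k}
    (hsurj : Function.Surjective b) (hb : A.BlockTriangular b) {c : Fin k}
    (hc : IsReducible (A.toSquareBlock b c)) :
    ∃ b' : κ → Fin (k + 1), Function.Surjective b' ∧ A.BlockTriangular b' := by
  classical
  obtain ⟨s, ⟨i₁, h₁⟩, ⟨i₀, h₀⟩, hs⟩ := (isReducible_iff _).mp hc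
  -- Rows in `s` vanish on columns outside `s`, so `s` must become the later half of block `c`; it
  -- moves up by one with all later blocks.
  let up : κ → Prop := fun i => c < b i ∨ ∃ h : b i = c, (⟨i, h⟩ : {i // b i = c}) ∈ s
  let b' : κ → Fin (k + 1) := fun i => if up i then (b i).succ else (b i).castSucc
  have hval : ∀ i, (b' i : ℕ) = if up i then (b i : ℕ) + 1 else b i := by
    intro i
    by_cases h : up i <;> simp [b', h]
  have hup : ∀ i, up i → c ≤ b i := by
    rintro i (h | ⟨h, -⟩)
    · exact h.le
    · exact h.ge
  have hdown : ∀ i, ¬ up i → b i ≤ c := fun i h => not_lt.mp fun h' => h (Or.inl h')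
  refine ⟨b', ?_, ?_⟩
  · intro d
    rcases lt_trichotomy (d : ℕ) c with hd | hd | hd
    · obtain ⟨i, hi⟩ := hsurj ⟨d, by omega⟩
      have : ¬ up i := by
        intro h
        have := hup i h
        rw [hi, Fin.le_def] at this
        simp at this
        omega
      refine ⟨i, Fin.ext ?_⟩
      rw [hval, if_neg this, hi]
    · refine ⟨i₀, Fin.ext ?_⟩
      have : ¬ up i₀ := by
        rintro (h | ⟨h, h'⟩)
        · exact absurd i₀.2 h.ne'
        · exact h₀ h'
      rw [hval, if_neg this, i₀.2, hd]
    · rcases Nat.lt_or_ge ((c : ℕ) + 1) d with hd' | hd'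
      · obtain ⟨i, hi⟩ := hsurj ⟨d - 1, by omega⟩
        have : up i := by
          refine Or.inl ?_
          rw [hi, Fin.lt_def]
          simp
          omega
        refine ⟨i, Fin.ext ?_⟩
        rw [hval, if_pos this, hi]
        simp
        omega
      · refine ⟨i₁, Fin.ext ?_⟩
        rw [hval, if_pos (Or.inr ⟨i₁.2, h₁⟩), i₁.2]
        omega
  · intro i j hij
    rw [Fin.lt_def, hval, hval] at hij
    rcases lt_trichotomy (b j) (b i) with h | h | h
    · exact hb h
    · have hval' : (b j : ℕ) = b i := congrArg Fin.val h
      have hi : up i := by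
        by_contra hi
        rw [if_neg hi] at hij
        split_ifs at hij <;> omega
      have hj : ¬ up j := by
        intro hj
        rw [if_pos hi, if_pos hj] at hij
        omega
      have hbi : b i = c := le_antisymm (h ▸ hdown j hj) (hup i hi)
      have hbj : b j = c := h.trans hbi
      refine hs ⟨i, hbi⟩ ?_ ⟨j, hbj⟩ fun hjs => hj (Or.inr ⟨hbj, hjs⟩)
      rcases hi with hi | ⟨_, hi⟩
      · exact absurd hbi hi.ne'
      · exact hi
    · rw [Fin.lt_def] at h
      have hj : ¬ up j := by
        intro hj
        rw [if_pos hj] at hij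
        split_ifs at hij <;> omega
      have hi : up i := by
        by_contra hi
        rw [if_neg hi, if_neg hj] at hij
        omega
      have h1 := hup i hi
      have h2 := hdown j hj
      rw [Fin.le_def] at h1 h2
      omega

/-- A form with the maximal number of nonempty blocks cannot be refined, so its blocks are
irreducible. -/
theorem exists_isIrreducibleBlockForm (A : Matrix ι ι ℂ) :
    ∃ (k : ℕ) (b : ι → Fin k), IsIrreducibleBlockForm A b := by
  classical
  let P : ℕ → Prop := fun k => ∃ b : ι → Fin k, Function.Surjective b ∧ A.BlockTriangular b
  have hcard : ∀ k, P k → k ≤ Fintype.card ι := by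
    rintro k ⟨b, hb, -⟩
    simpa using Fintype.card_le_of_surjective b hb
  have hex : ∃ k, P k := by
    rcases isEmpty_or_nonempty ι with hι | hι
    · exact ⟨0, isEmptyElim, fun c => c.elim0, fun i => isEmptyElim i⟩
    · refine ⟨1, fun _ => 0, fun c => ⟨Classical.arbitrary ι, Subsingleton.elim _ _⟩, ?_⟩
      intro i j hij
      exact absurd hij (lt_irrefl _)
  obtain ⟨k₀, hk₀⟩ := hex
  obtain ⟨b, hsurj, hb⟩ := Nat.findGreatest_spec (hcard k₀ hk₀) hk₀
  refine ⟨_, b, hsurj, hb, fun c hc => ?_⟩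
  have hP : P (Nat.findGreatest P (Fintype.card ι) + 1) :=
    exists_refinement_of_isReducible hsurj hb hc
  have := Nat.le_findGreatest (hcard _ hP) hP
  omega

/-! ### Sufficiency of the invariant, and unitary similarity -/

theorem HasPositiveDiagonalInvariant.isUnilossless {A : Matrix ι ι ℂ}
    (hA : HasPositiveDiagonalInvariant A) : IsUnilossless A := by
  obtain ⟨e, he, hE⟩ := hA
  intro m hm z hz
  rw [IsRoot.def, eval_genCharpoly] at hz
  obtain ⟨v, hv0, hv⟩ := exists_vecMul_eq_zero_iff.mpr hz
  rw [vecMul_sub, sub_eq_zero] at hv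
  have hvec : v ᵥ* diagonal (fun i => z ^ m i) ᵥ* diagonal (fun i => (e i : ℂ)) ⬝ᵥ
      star (v ᵥ* diagonal fun i => z ^ m i) = v ᵥ* diagonal (fun i => (e i : ℂ)) ⬝ᵥ star v := by
    rw [hv, star_vecMul, dotProduct_mulVec, vecMul_vecMul, vecMul_vecMul, ← mul_assoc, hE]
  -- A left null vector satisfies `v W = v A` with `W = diag (z ^ m i)`, so `v` and `v W` have equal
  -- `E`-norm. If `‖z‖ ≠ 1`, all terms have one sign and one is nonzero.
  have hsum : ∑ i, e i * ‖v i‖ ^ 2 * ((‖z‖ ^ m i) ^ 2 - 1) = 0 := by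
    have h : ((∑ i, e i * ‖v i‖ ^ 2 * ((‖z‖ ^ m i) ^ 2 - 1) : ℝ) : ℂ) = 0 := by
      rw [← sub_eq_zero] at hvec
      rw [← hvec]
      simp only [dotProduct, vecMul_diagonal, Pi.star_apply]
      rw [← Finset.sum_sub_distrib]
      push_cast
      refine Finset.sum_congr rfl fun i _ => ?_
      have h1 : v i * star (v i) = (‖v i‖ : ℂ) ^ 2 := Complex.mul_conj' _
      have h2 : z ^ m i * star (z ^ m i) = ((‖z‖ : ℂ) ^ m i) ^ 2 := by
        have := Complex.mul_conj' (z ^ m i)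
        rw [norm_pow, Complex.ofReal_pow] at this
        exact this
      rw [star_mul', ← h1, ← h2]
      ring
    exact_mod_cast h
  obtain ⟨k, hk⟩ := Function.ne_iff.mp hv0
  have hkpos : 0 < e k * ‖v k‖ ^ 2 := mul_pos (he k) (pow_pos (norm_pos_iff.mpr hk) 2)
  have hmk : ∀ i, m i ≠ 0 := fun i => Nat.one_le_iff_ne_zero.mp (hm i)
  by_contra hne
  rcases lt_or_gt_of_ne hne with hlt | hgt
  · have hneg : ∀ i, (‖z‖ ^ m i) ^ 2 - 1 < 0 := fun i => by
      have h1 := pow_lt_one₀ (norm_nonneg z) hlt (hmk i)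
      have h0 : 0 ≤ ‖z‖ ^ m i := by positivity
      nlinarith
    refine (Finset.sum_neg' (s := Finset.univ) (fun i _ => ?_)
      ⟨k, Finset.mem_univ k, mul_neg_of_pos_of_neg hkpos (hneg k)⟩).ne hsum
    exact mul_nonpos_of_nonneg_of_nonpos (mul_nonneg (he i).le (sq_nonneg _)) (hneg i).le
  · have hpos : ∀ i, 0 < (‖z‖ ^ m i) ^ 2 - 1 := fun i => by
      have h1 := one_lt_pow₀ hgt (hmk i)
      nlinarith
    refine (Finset.sum_pos' (s := Finset.univ) (fun i _ => ?_)
      ⟨k, Finset.mem_univ k, mul_pos hkpos (hpos k)⟩).ne' hsum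
    exact mul_nonneg (mul_nonneg (he i).le (sq_nonneg _)) (hpos i).le

/-- Unitarity of `F⁻¹ A F`, conjugated by `F` and `Fᴴ`, is invariance of `F Fᴴ = diag (‖f i‖ ^ 2)`.
-/
theorem inv_diagonal_mul_mul_mem_unitaryGroup_iff (A : Matrix ι ι ℂ) {f : ι → ℂ}
    (hf : ∀ i, f i ≠ 0) :
    (diagonal f)⁻¹ * A * diagonal f ∈ unitaryGroup ι ℂ ↔
      A * diagonal (fun i => ((‖f i‖ ^ 2 : ℝ) : ℂ)) * Aᴴ =
        diagonal fun i => ((‖f i‖ ^ 2 : ℝ) : ℂ) := by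
  have hunit : IsUnit (diagonal f).det := by
    rw [det_diagonal]
    exact isUnit_iff_ne_zero.mpr (Finset.prod_ne_zero_iff.mpr fun i _ => hf i)
  have hunit' : IsUnit (diagonal f)ᴴ.det := by
    rw [det_conjTranspose]
    exact hunit.star
  have hFF : diagonal (fun i => ((‖f i‖ ^ 2 : ℝ) : ℂ)) = diagonal f * (diagonal f)ᴴ := by
    rw [diagonal_conjTranspose, diagonal_mul_diagonal]
    congr 1
    ext i
    rw [Complex.ofReal_pow]
    exact (Complex.mul_conj' (f i)).symm
  rw [mem_unitaryGroup_iff, hFF, star_eq_conjTranspose, conjTranspose_mul, conjTranspose_mul,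
    conjTranspose_nonsing_inv]
  set F := diagonal f
  constructor
  · intro h
    calc A * (F * Fᴴ) * Aᴴ = F * (F⁻¹ * A * F * (Fᴴ * (Aᴴ * Fᴴ⁻¹))) * Fᴴ := by
          simp only [← mul_assoc, mul_nonsing_inv _ hunit, one_mul]
          rw [mul_assoc _ Fᴴ⁻¹, nonsing_inv_mul _ hunit', mul_one]
      _ = F * Fᴴ := by rw [h, mul_one]
  · intro h
    calc F⁻¹ * A * F * (Fᴴ * (Aᴴ * Fᴴ⁻¹)) = F⁻¹ * (A * (F * Fᴴ) * Aᴴ) * Fᴴ⁻¹ := by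
          simp only [mul_assoc]
      _ = 1 := by
          rw [h, ← mul_assoc, nonsing_inv_mul _ hunit, one_mul, mul_nonsing_inv _ hunit']

theorem hasPositiveDiagonalInvariant_iff (A : Matrix ι ι ℂ) :
    HasPositiveDiagonalInvariant A ↔ IsDiagonallySimilarToUnitary A := by
  constructor
  · rintro ⟨e, he, hE⟩
    have hf : ∀ i, ((√(e i) : ℝ) : ℂ) ≠ 0 := fun i => by
      exact_mod_cast (Real.sqrt_pos.mpr (he i)).ne'
    refine ⟨fun i => (√(e i) : ℝ), hf, ?_⟩
    rw [inv_diagonal_mul_mul_mem_unitaryGroup_iff A hf]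
    simpa only [Complex.norm_real, Real.norm_eq_abs, sq_abs, Real.sq_sqrt (he _).le] using hE
  · rintro ⟨f, hf, hU⟩
    exact ⟨fun i => ‖f i‖ ^ 2, fun i => pow_pos (norm_pos_iff.mpr (hf i)) 2,
      (inv_diagonal_mul_mul_mem_unitaryGroup_iff A hf).mp hU⟩

end FDN

theorem theorem1 (N : ℕ) (A : Matrix (Fin N) (Fin N) ℂ) :
    (FDN.IsUnilossless A ↔
      (FDN.IsReducible A ∧ FDN.AllComponentsUnilossless A) ∨
        FDN.HasPositiveDiagonalInvariant A) ∧
    (FDN.HasPositiveDiagonalInvariant A ↔ FDN.IsDiagonallySimilarToUnitary A) := by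
  refine ⟨⟨fun hA => ?_, ?_⟩, FDN.hasPositiveDiagonalInvariant_iff A⟩
  · by_cases hred : FDN.IsReducible A
    · exact Or.inl ⟨hred, fun k b hb c => hA.toSquareBlock hb.blockTriangular c⟩
    · exact Or.inr (hA.hasPositiveDiagonalInvariant hred)
  · rintro (⟨-, hcomp⟩ | hinv)
    · obtain ⟨k, b, hb⟩ := FDN.exists_isIrreducibleBlockForm A
      exact FDN.isUnilossless_of_blocks hb.blockTriangular (hcomp k b hb)
    · exact hinv.isUnilossless
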